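/- Let \(G\) be a finite simple graph with \(n\) vertices and let \(k\) be an integer with \(0\le k\le n\); if \(k=0\), assume that \(G\) has no isolated vertices. Let \(\mathcal S(G)\) be the set of real symmetric matrices \(A=[a_{ij}]\), with rows and columns indexed by the vertices of \(G\), such that for all \(i\neq j\), \(a_{ij}\neq 0\) if and only if \(i\) and \(j\) are adjacent in \(G\) (the diagonal entries are arbitrary). The spark of a singular matrix \(A\in\mathcal S(G)\), written \(\operatorname{spark}(A)\), is the smallest \(s\) such that some \(s\) columns of \(A\) are linearly dependent; for nonsingular \(A\in\mathcal S(G)\), \(\operatorname{spark}(A)=n+1\). The vertex connectivity \(\kappa(G)\) is the smallest number of vertices whose deletion leaves a disconnected graph or at most one vertex (so \(\kappa(K_n)=n-1\) for \(n\ge 1\)), and \(G\) is \(m\)-connected if \(\kappa(G)\ge m\). A non-neighbor of a vertex \(v\) is a vertex that is different from \(v\) and not adjacent to \(v\). Then the following are equivalent: 1. \(G\) is \((n-k)\)-connected. 2. There exists \(A\in\mathcal S(G)\) with \(\operatorname{rank}(A)=k\) and \(\operatorname{spark}(A)=k+1\). 3. There exists \(A\in\mathcal S(G)\) with \(\operatorname{rank}(A)=k\)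 such that for every vertex \(v\) of \(G\) the columns of \(A\) corresponding to \(v\) and its non-neighbors are linearly independent. 4. There exists \(A\in\mathcal S(G)\) with \(\operatorname{rank}(A)=k\) such that for every vertex \(v\) of \(G\) the columns of \(A\) corresponding to the non-neighbors of \(v\) are linearly independent. -/

import Mathlib

/-- `𝒮(G)`: the real symmetric matrices, indexed by the vertices of `G`, whose off-diagonal
nonzero pattern is given by the edges of `G`; the diagonal entries are arbitrary. -/
def matricesOf {V : Type*} (G : SimpleGraph V) : Set (Matrix V V ℝ) :=
  {A | A.IsSymm ∧ ∀ i j, i ≠ j → (A i j ≠ 0 ↔ G.Adj i j)}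

/-- The spark of a square real matrix: the smallest size of a set of columns that is linearly
dependent (as an indexed family, so that repeated columns are dependent). By convention it is
`n + 1` for a nonsingular matrix of order `n`. -/
noncomputable def spark {V : Type*} [Fintype V] [DecidableEq V] (A : Matrix V V ℝ) : ℕ :=
  if A.det ≠ 0 then Fintype.card V + 1
  else sInf {s | ∃ S : Finset V, S.card = s ∧ ¬ LinearIndepOn ℝ A.col (S : Set V)}

/-- `C` is a cut set of `G`: deleting the vertices in `C` leaves a disconnected graph. -/
def IsCutSet {V : Type*} (G : SimpleGraph V) (C : Finset V) : Prop :=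
  ¬ (G.induce {v | v ∉ C}).Preconnected

/-- The vertex connectivity `κ(G)`: the smallest number of vertices whose deletion leaves a
disconnected graph or at most one vertex. The second alternative matters only for
complete graphs, which have no cut set; it gives the usual value `κ(Kₙ) = n - 1`. -/
noncomputable def vertexConnectivity {V : Type*} [Fintype V] (G : SimpleGraph V) : ℕ :=
  sInf {s | ∃ C : Finset V, C.card = s ∧ (IsCutSet G C ∨ Fintype.card V ≤ C.card + 1)}

/-- `G` is `m`-connected: `κ(G) ≥ m`. -/
def IsVertexConnected {V : Type*} [Fintype V] (G : SimpleGraph V) (m : ℕ) : Prop :=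
  m ≤ vertexConnectivity G

/-- The non-neighbors of `v`: the vertices different from `v` and not adjacent to `v`. -/
def nonNeighbors {V : Type*} (G : SimpleGraph V) (v : V) : Set V :=
  {w | w ≠ v ∧ ¬ G.Adj v w}

/-! Being (n-k)-connected amounts to `SeparatedCardLE G k`: deleting everything outside two
separated sets is a cut.

From 4 to 1, separated sets S and T index a zero block of A, and each lies among the non-neighbors
of any vertex of the other, so both index independent columns. Rank-nullity then gives |S| + |T| ≤
rank A (`Matrix.card_add_card_le_rank_of_block_zero`).

From 1 to 2, A is the Gram matrix of vectors in ℝ^k in general position that are orthogonal exactly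
at non-adjacent pairs, as in the theorem of Lovász, Saks and Schrijver. Such vectors come from a
genericity argument: the general-position orthogonal representations form a nonempty irreducible set
(`genericReps_irreducible`), so finitely many analytic conditions that are satisfiable one at a time
are satisfiable together. The induction adds one vertex v at a time. Its vector ranges over the
orthogonal complement of independent vectors, which preserves irreducibility, and connectivity makes
the choice of the last vertex immaterial (`genericReps_transfer_adj`).

From 2 to 3, a vertex with at least k non-neighbors would have a zero column
(`linearIndepOn_col_closed_nonNeighbors`). -/

/-! ### Analytic irreducibility -/

/-- A set `Y` is analytically irreducible if two real-analytic functions that do not vanish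
identically on `Y` have a common nonvanishing point on `Y`. -/
def AnalyticIrreducible {M : Type*} [NormedAddCommGroup M] [NormedSpace ℝ M] (Y : Set M) : Prop :=
  ∀ p q : M → ℝ, ContDiff ℝ ⊤ p → ContDiff ℝ ⊤ q →
    (∃ y ∈ Y, p y ≠ 0) → (∃ y ∈ Y, q y ≠ 0) → ∃ y ∈ Y, p y ≠ 0 ∧ q y ≠ 0

namespace AnalyticIrreducible

variable {M : Type*} [NormedAddCommGroup M] [NormedSpace ℝ M]

theorem exists_ne_zero_of_real {a b : ℝ → ℝ} (ha : ContDiff ℝ ⊤ a) (hb : ContDiff ℝ ⊤ b)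
    (ha0 : ∃ t, a t ≠ 0) (hb0 : ∃ t, b t ≠ 0) : ∃ t, a t ≠ 0 ∧ b t ≠ 0 := by
  by_contra! h
  -- Here `⊤` is the analytic exponent ω; the statement fails for merely smooth functions.
  have ha' := contDiff_omega_iff_analyticOnNhd.1 ha
  have hb' := contDiff_omega_iff_analyticOnNhd.1 hb
  obtain ⟨s, hs⟩ := ha0
  obtain ⟨t, ht⟩ := hb0
  rcases ha'.eq_zero_or_eq_zero_of_mul_eq_zero hb'
    (fun z _ => by
      by_cases hz : a z = 0
      · simp [hz]
      · simp [h z hz]) isPreconnected_univ with h1 | h1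
  · exact hs (h1 s (Set.mem_univ _))
  · exact ht (h1 t (Set.mem_univ _))

theorem of_convex {Y : Set M} (hY : ∀ x ∈ Y, ∀ y ∈ Y, ∀ t : ℝ, x + t • (y - x) ∈ Y) :
    AnalyticIrreducible Y := by
  rintro p q hp hq ⟨x, hx, hpx⟩ ⟨y, hy, hqy⟩
  obtain ⟨t, h1, h2⟩ := exists_ne_zero_of_real
    (a := fun t : ℝ => p (x + t • (y - x))) (b := fun t : ℝ => q (x + t • (y - x)))
    (hp.comp (by fun_prop)) (hq.comp (by fun_prop)) ⟨0, by simpa using hpx⟩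
    ⟨1, by simpa using hqy⟩
  exact ⟨_, hY x hx y hy t, h1, h2⟩

theorem inter_ne_zero {Y : Set M} (hY : AnalyticIrreducible Y) {r : M → ℝ}
    (hr : ContDiff ℝ ⊤ r) : AnalyticIrreducible {y ∈ Y | r y ≠ 0} := by
  rintro p q hp hq ⟨x, ⟨hx, hrx⟩, hpx⟩ ⟨y, ⟨hy, hry⟩, hqy⟩
  obtain ⟨z, hz, h1, h2⟩ := hY (fun x => p x * r x) (fun x => q x * r x) (hp.mul hr) (hq.mul hr)
    ⟨x, hx, mul_ne_zero hpx hrx⟩ ⟨y, hy, mul_ne_zero hqy hry⟩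
  exact ⟨z, ⟨hz, right_ne_zero_of_mul h1⟩, left_ne_zero_of_mul h1, left_ne_zero_of_mul h2⟩

theorem exists_prod_ne_zero {Y : Set M} (hY : AnalyticIrreducible Y) (hne : Y.Nonempty)
    {ι : Type*} (s : Finset ι) (p : ι → M → ℝ) (hp : ∀ i ∈ s, ContDiff ℝ ⊤ (p i))
    (h0 : ∀ i ∈ s, ∃ y ∈ Y, p i y ≠ 0) : ∃ y ∈ Y, ∏ i ∈ s, p i y ≠ 0 := by
  classical
  induction s using Finset.induction_on with
  | empty => obtain ⟨y, hy⟩ := hne; exact ⟨y, hy, by simp⟩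
  | insert i s hi ih =>
    obtain ⟨y, hy, h1, h2⟩ := hY (p i) (fun y => ∏ i ∈ s, p i y) (hp i (by simp))
      (contDiff_prod fun j hj => hp j (by simp [hj])) (h0 i (by simp))
      (ih (fun j hj => hp j (by simp [hj])) fun j hj => h0 j (by simp [hj]))
    exact ⟨y, hy, by rw [Finset.prod_insert hi]; exact mul_ne_zero h1 h2⟩

end AnalyticIrreducible

set_option linter.unusedSectionVars false

/-! ### Gram determinants and polynomial projections -/

section GramFunctions

variable {V E : Type*} [Fintype V] [DecidableEq V] [NormedAddCommGroup E] [InnerProductSpace ℝ E]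

theorem ContDiff.matrix_det {M : Type*} [NormedAddCommGroup M] [NormedSpace ℝ M]
    {n : Type*} [Fintype n] [DecidableEq n] {B : M → Matrix n n ℝ}
    (hB : ∀ i j, ContDiff ℝ ⊤ fun x => B x i j) : ContDiff ℝ ⊤ fun x => (B x).det := by
  simp only [Matrix.det_apply]
  exact ContDiff.sum fun σ _ => (contDiff_prod fun i _ => hB _ _).const_smul _

theorem ContDiff.matrix_adjugate {M : Type*} [NormedAddCommGroup M] [NormedSpace ℝ M]
    {n : Type*} [Fintype n] [DecidableEq n] {B : M → Matrix n n ℝ}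
    (hB : ∀ i j, ContDiff ℝ ⊤ fun x => B x i j) (i j : n) :
    ContDiff ℝ ⊤ fun x => (B x).adjugate i j := by
  simp only [Matrix.adjugate_apply]
  refine ContDiff.matrix_det fun k l => ?_
  by_cases hk : k = j
  · subst hk; simpa using contDiff_const
  · simpa [Matrix.updateRow_ne hk] using hB k l

/-- The Gram matrix of the vectors `f i`, `i ∈ T`. -/
def gramOn (T : Finset V) (f : V → E) : Matrix T T ℝ := Matrix.gram ℝ fun i : T => f i

theorem contDiff_gramOn (T : Finset V) (i j : T) :
    ContDiff ℝ ⊤ fun f : V → E => gramOn T f i j := by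
  simp only [gramOn, Matrix.gram_apply]
  exact (contDiff_apply ℝ E (i : V)).inner ℝ (contDiff_apply ℝ E (j : V))

theorem det_gramOn_ne_zero_iff (T : Finset V) (f : V → E) :
    (gramOn T f).det ≠ 0 ↔ LinearIndepOn ℝ f (T : Set V) :=
  Matrix.det_gram_ne_zero_iff_linearIndependent

/-- A multiple of the projection of `z` to the orthogonal complement of the `f i`, `i ∈ T`, that
depends polynomially on `f`. -/
noncomputable def scaledProjection (T : Finset V) (z : E) (f : V → E) : E :=
  (gramOn T f).det • z -
    ∑ i : T, ((gramOn T f).adjugate.mulVec fun j : T => inner ℝ (f j) z) i • f i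

theorem contDiff_scaledProjection (T : Finset V) (z : E) :
    ContDiff ℝ ⊤ fun f : V → E => scaledProjection T z f := by
  unfold scaledProjection
  refine ((ContDiff.matrix_det (contDiff_gramOn T)).smul contDiff_const).sub
    (ContDiff.sum fun i _ => ContDiff.smul ?_ (contDiff_apply ℝ E (i : V)))
  simp only [Matrix.mulVec, dotProduct]
  exact ContDiff.sum fun j _ => (ContDiff.matrix_adjugate (contDiff_gramOn T) i j).mul
    ((contDiff_apply ℝ E (j : V)).inner ℝ contDiff_const)

theorem inner_scaledProjection (T : Finset V) (z : E) (f : V → E) {i : V} (hi : i ∈ T) :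
    inner ℝ (f i) (scaledProjection T z f) = 0 := by
  set w : T → ℝ := fun j : T => inner ℝ (f j) z with hw
  have h : (gramOn T f).mulVec ((gramOn T f).adjugate.mulVec w) ⟨i, hi⟩
      = (gramOn T f).det * inner ℝ (f i) z := by
    rw [Matrix.mulVec_mulVec, Matrix.mul_adjugate, Matrix.smul_mulVec, Matrix.one_mulVec]
    simp [hw]
  rw [scaledProjection, inner_sub_right, inner_smul_right, inner_sum, ← h, sub_eq_zero]
  simp only [Matrix.mulVec, dotProduct, inner_smul_right, gramOn, Matrix.gram_apply]
  exact Finset.sum_congr rfl fun j _ => mul_comm _ _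

theorem scaledProjection_of_orthogonal (T : Finset V) (z : E) (f : V → E)
    (h : ∀ i ∈ T, inner ℝ (f i) z = 0) : scaledProjection T z f = (gramOn T f).det • z := by
  have : (fun j : T => inner ℝ (f j) z) = 0 := funext fun j => h j j.2
  simp [scaledProjection, this]

/-- The new set fibers over `Y` in linear spaces. Moving `f v` by `scaledProjection` pulls `p` and
`q` back to analytic functions on `Y`, which are nonzero at a common `f`; the two resulting points
share a fiber, where a line joins them. -/
theorem AnalyticIrreducible.orthogonal_extension {Y : Set (V → E)} {v : V} {T : Finset V}
    (hY : AnalyticIrreducible Y) (hvT : v ∉ T) (hupd : ∀ f ∈ Y, ∀ x, Function.update f v x ∈ Y)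
    (hT : ∀ f ∈ Y, LinearIndepOn ℝ f (T : Set V)) :
    AnalyticIrreducible {f ∈ Y | ∀ i ∈ T, inner ℝ (f i) (f v) = 0} := by
  have key : ∀ p : (V → E) → ℝ, ContDiff ℝ ⊤ p →
      (∃ f ∈ {f ∈ Y | ∀ i ∈ T, inner ℝ (f i) (f v) = 0}, p f ≠ 0) →
      ∃ z : E, ∃ f ∈ Y, p (Function.update f v (scaledProjection T z f)) ≠ 0 := by
    rintro p - ⟨f, ⟨hf, hfT⟩, hp⟩
    have hdet := (det_gramOn_ne_zero_iff T f).2 (hT f hf)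
    -- The inverse determinant cancels the scaling, so the projection returns `f v` itself.
    refine ⟨(gramOn T f).det⁻¹ • f v, f, hf, ?_⟩
    rw [scaledProjection_of_orthogonal _ _ _ fun i hi => by simp [inner_smul_right, hfT i hi],
      smul_smul, mul_inv_cancel₀ hdet, one_smul, Function.update_eq_self]
    exact hp
  have smooth : ∀ z : E,
      ContDiff ℝ ⊤ fun f : V → E => Function.update f v (scaledProjection T z f) := by
    intro z
    rw [contDiff_pi]
    intro u
    by_cases hu : u = v
    · subst hu; simpa using contDiff_scaledProjection T z
    · simpa [Function.update_of_ne hu] using contDiff_apply ℝ E u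
  intro p q hp hq hp0 hq0
  obtain ⟨z, hz⟩ := key p hp hp0
  obtain ⟨z', hz'⟩ := key q hq hq0
  obtain ⟨f, hf, h1, h2⟩ := hY _ _ (hp.comp (smooth z)) (hq.comp (smooth z')) hz hz'
  set x := scaledProjection T z f
  set y := scaledProjection T z' f
  have hline : AnalyticIrreducible
      {g | ∃ u : E, (∀ i ∈ T, inner ℝ (f i) u = 0) ∧ g = Function.update f v u} := by
    apply AnalyticIrreducible.of_convex
    rintro _ ⟨u, hu, rfl⟩ _ ⟨u', hu', rfl⟩ t
    refine ⟨u + t • (u' - u), fun i hi => ?_, ?_⟩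
    · simp [inner_add_right, inner_smul_right, inner_sub_right, hu i hi, hu' i hi]
    · ext w
      by_cases hw : w = v
      · subst hw; simp
      · simp [Function.update_of_ne hw]
  obtain ⟨_, ⟨u, hu, rfl⟩, h3, h4⟩ := hline p q hp hq
    ⟨_, ⟨x, fun i hi => inner_scaledProjection T z f hi, rfl⟩, h1⟩
    ⟨_, ⟨y, fun i hi => inner_scaledProjection T z' f hi, rfl⟩, h2⟩
  refine ⟨_, ⟨hupd f hf u, fun i hi => ?_⟩, h3, h4⟩
  have hiv : i ≠ v := fun h => hvT (h ▸ hi)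
  simpa [Function.update_of_ne hiv] using hu i hi

end GramFunctions

/-! ### Orthogonal representations in general position -/

section OrthogonalRepresentations

variable {V E : Type*} [Fintype V] [DecidableEq V] [NormedAddCommGroup E] [InnerProductSpace ℝ E]

/-- The product of the Gram determinants of the families `f i`, `i ∈ T`, over the subsets `T` of
`R` with at most `d` elements. -/
noncomputable def gramProduct (d : ℕ) (R : Finset V) (f : V → E) : ℝ :=
  ∏ T ∈ R.powerset with T.card ≤ d, (gramOn T f).det

theorem contDiff_gramProduct (d : ℕ) (R : Finset V) :
    ContDiff ℝ ⊤ (gramProduct d R : (V → E) → ℝ) :=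
  contDiff_prod fun T _ => ContDiff.matrix_det (contDiff_gramOn T)

theorem gramProduct_ne_zero_iff {d : ℕ} {R : Finset V} {f : V → E} :
    gramProduct d R f ≠ 0 ↔ ∀ T ⊆ R, T.card ≤ d → LinearIndepOn ℝ f (T : Set V) := by
  simp [gramProduct, Finset.prod_ne_zero_iff, ← det_gramOn_ne_zero_iff]

theorem gramProduct_ne_zero_mono {d : ℕ} {R S : Finset V} (h : R ⊆ S) {f : V → E}
    (hf : gramProduct d S f ≠ 0) : gramProduct d R f ≠ 0 :=
  gramProduct_ne_zero_iff.2 fun T hT => gramProduct_ne_zero_iff.1 hf T (hT.trans h)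

theorem linearIndepOn_update_iff {f : V → E} {v : V} {T : Finset V} (hv : v ∉ T) (x : E) :
    LinearIndepOn ℝ (Function.update f v x) (T : Set V) ↔ LinearIndepOn ℝ f (T : Set V) :=
  linearIndepOn_congr fun i hi => Function.update_of_ne (fun h => hv (by simpa [h] using hi)) _ _

theorem gramProduct_update_ne_zero_iff {d : ℕ} {R : Finset V} {f : V → E} {v : V} (hv : v ∉ R)
    (x : E) : gramProduct d R (Function.update f v x) ≠ 0 ↔ gramProduct d R f ≠ 0 := by
  simp only [gramProduct_ne_zero_iff]
  exact forall₂_congr fun T hT => by rw [linearIndepOn_update_iff fun h => hv (hT h)]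

/-- The orthogonal representations of `G` on `S` for which any at most `d` vectors with indices
in `R` are linearly independent. -/
def genericReps (E : Type*) [NormedAddCommGroup E] [InnerProductSpace ℝ E] (G : SimpleGraph V)
    (d : ℕ) (S R : Finset V) : Set (V → E) :=
  {f | (∀ u ∈ S, ∀ v ∈ S, u ≠ v → ¬ G.Adj u v → inner ℝ (f u) (f v) = 0) ∧
    gramProduct d R f ≠ 0}

/-- There are no two nonempty sets without edges between them that have more than `d` elements
in total. -/
def SeparatedCardLE (G : SimpleGraph V) (d : ℕ) : Prop :=
  ∀ A B : Finset V, Disjoint A B → A.Nonempty → B.Nonempty →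
    (∀ a ∈ A, ∀ b ∈ B, ¬ G.Adj a b) → A.card + B.card ≤ d

variable {G : SimpleGraph V} {d : ℕ}

open Classical in
/-- The non-neighbors of `v` in `S`. -/
noncomputable def nonNeighborsIn (G : SimpleGraph V) (S : Finset V) (v : V) : Finset V :=
  {u ∈ S | u ≠ v ∧ ¬ G.Adj u v}

theorem mem_nonNeighborsIn {S : Finset V} {u v : V} :
    u ∈ nonNeighborsIn G S v ↔ u ∈ S ∧ u ≠ v ∧ ¬ G.Adj u v := by
  simp [nonNeighborsIn]

theorem SeparatedCardLE.card_nonNeighborsIn_lt (hG : SeparatedCardLE G d) (hd : 1 ≤ d)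
    (S : Finset V) (v : V) : (nonNeighborsIn G S v).card < d := by
  rcases (nonNeighborsIn G S v).eq_empty_or_nonempty with h | h
  · rw [h, Finset.card_empty]; omega
  · have := hG (nonNeighborsIn G S v) {v}
      (by simp [mem_nonNeighborsIn]) h (by simp) (by simp +contextual [mem_nonNeighborsIn])
    simpa using this

theorem update_mem_genericReps {S R : Finset V} {v : V} (hvR : v ∉ R)
    {f : V → E} (hf : f ∈ genericReps E G d (S.erase v) R) {x : E}
    (hx : ∀ i ∈ nonNeighborsIn G S v, inner ℝ (f i) x = 0) :
    Function.update f v x ∈ genericReps E G d S R := by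
  refine ⟨fun u hu w hw huw hadj => ?_, (gramProduct_update_ne_zero_iff hvR x).2 hf.2⟩
  by_cases h1 : u = v
  · subst h1
    rw [Function.update_self, Function.update_of_ne huw.symm, real_inner_comm]
    exact hx w (mem_nonNeighborsIn.2 ⟨hw, huw.symm, fun h => hadj h.symm⟩)
  · by_cases h2 : w = v
    · subst h2
      rw [Function.update_self, Function.update_of_ne h1]
      exact hx u (mem_nonNeighborsIn.2 ⟨hu, h1, hadj⟩)
    · rw [Function.update_of_ne h1, Function.update_of_ne h2]
      exact hf.1 u (by simp [h1, hu]) w (by simp [h2, hw]) huw hadj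

theorem genericReps_eq_of_erase {S R : Finset V} {v : V} (hv : v ∈ S) :
    genericReps E G d S R = {f ∈ genericReps E G d (S.erase v) R |
      ∀ i ∈ nonNeighborsIn G S v, inner ℝ (f i) (f v) = 0} := by
  ext f
  constructor
  · rintro ⟨h1, h2⟩
    refine ⟨⟨fun u hu w hw => h1 u (Finset.mem_of_mem_erase hu) w (Finset.mem_of_mem_erase hw), h2⟩,
      fun i hi => ?_⟩
    obtain ⟨h3, h4, h5⟩ := mem_nonNeighborsIn.1 hi
    exact h1 i h3 v hv h4 h5
  · rintro ⟨⟨h1, h2⟩, h3⟩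
    refine ⟨fun u hu w hw huw hadj => ?_, h2⟩
    by_cases hu' : u = v
    · subst hu'
      rw [real_inner_comm]
      exact h3 w (mem_nonNeighborsIn.2 ⟨hw, huw.symm, fun h => hadj h.symm⟩)
    · by_cases hw' : w = v
      · subst hw'
        exact h3 u (mem_nonNeighborsIn.2 ⟨hu, hu', hadj⟩)
      · exact h1 u (by simp [hu', hu]) w (by simp [hw', hw]) huw hadj

theorem genericReps_extension {S R : Finset V} {v : V} (hv : v ∈ S) (hvR : v ∉ R)
    (hsub : nonNeighborsIn G S v ⊆ R) (hcard : (nonNeighborsIn G S v).card ≤ d)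
    (h : AnalyticIrreducible (genericReps E G d (S.erase v) R))
    (hne : (genericReps E G d (S.erase v) R).Nonempty) :
    AnalyticIrreducible (genericReps E G d S R) ∧ (genericReps E G d S R).Nonempty := by
  refine ⟨?_, ?_⟩
  · rw [genericReps_eq_of_erase hv]
    refine h.orthogonal_extension (fun h => hvR (hsub h)) (fun f hf x => ?_)
      fun f hf => gramProduct_ne_zero_iff.1 hf.2 _ hsub hcard
    refine ⟨fun u hu w hw => ?_, (gramProduct_update_ne_zero_iff hvR x).2 hf.2⟩
    rw [Function.update_of_ne (Finset.ne_of_mem_erase hu),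
      Function.update_of_ne (Finset.ne_of_mem_erase hw)]
    exact hf.1 u hu w hw
  · obtain ⟨f, hf⟩ := hne
    exact ⟨_, update_mem_genericReps hvR hf (x := 0) (by simp)⟩

theorem genericReps_anti {S R R' : Finset V} (h : R ⊆ R') :
    genericReps E G d S R' ⊆ genericReps E G d S R :=
  fun _ hf => ⟨hf.1, gramProduct_ne_zero_mono h hf.2⟩

theorem exists_mem_inter_genericReps {S R R' : Finset V}
    (h : AnalyticIrreducible (genericReps E G d S R)) (hRR' : R ⊆ R')
    (hne : (genericReps E G d S R').Nonempty) {p : (V → E) → ℝ} (hp : ContDiff ℝ ⊤ p)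
    (hp0 : ∃ f ∈ genericReps E G d S R, p f ≠ 0) : ∃ f ∈ genericReps E G d S R', p f ≠ 0 := by
  obtain ⟨g, hg⟩ := hne
  obtain ⟨f, hf, h1, h2⟩ := h p _ hp (contDiff_gramProduct d R') hp0
    ⟨g, genericReps_anti hRR' hg, hg.2⟩
  exact ⟨f, ⟨hf.1, h2⟩, h1⟩

/-- With `R = S \ {u, v}`, the sets for `S.erase u` and `S.erase v` are both nonempty loci of
nonvanishing in `genericReps E G d S R`. That set is irreducible because `u` and `v` can be added to
`R` in turn: adjacency keeps `v` out of the non-neighbors of `u`. Hence the two loci meet, and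
irreducibility of the first gives a common point with `p` nonzero. -/
theorem genericReps_transfer_adj (hG : SeparatedCardLE G d) (hd : 1 ≤ d) {S : Finset V}
    (ih : ∀ R : Finset V, R ⊂ S →
      AnalyticIrreducible (genericReps E G d R R) ∧ (genericReps E G d R R).Nonempty)
    (hZ : ∀ v ∈ S, AnalyticIrreducible (genericReps E G d S (S.erase v)))
    {u v : V} (hu : u ∈ S) (hv : v ∈ S) (huv : G.Adj u v) {p : (V → E) → ℝ}
    (hp : ContDiff ℝ ⊤ p) (hpu : ∃ f ∈ genericReps E G d S (S.erase u), p f ≠ 0) :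
    ∃ f ∈ genericReps E G d S (S.erase v), p f ≠ 0 := by
  have hne : u ≠ v := huv.ne
  set R := (S.erase u).erase v with hR
  have hcard : ∀ T w, (nonNeighborsIn G T w).card ≤ d :=
    fun T w => (hG.card_nonNeighborsIn_lt hd T w).le
  have huR : u ∉ R := by simp [hR]
  have hvR : v ∉ R := by simp [hR]
  obtain ⟨i0, n0⟩ := ih R ((Finset.erase_subset _ _).trans_ssubset (Finset.erase_ssubset hu))
  have hsub1 : nonNeighborsIn G (S.erase u) v ⊆ R := fun w hw => by
    obtain ⟨h1, h2, -⟩ := mem_nonNeighborsIn.1 hw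
    exact Finset.mem_erase.2 ⟨h2, h1⟩
  obtain ⟨i1, n1⟩ := genericReps_extension (Finset.mem_erase.2 ⟨hne.symm, hv⟩) hvR hsub1
    (hcard _ _) i0 n0
  have hsub2 : nonNeighborsIn G S u ⊆ R := fun w hw => by
    obtain ⟨h1, h2, h3⟩ := mem_nonNeighborsIn.1 hw
    exact Finset.mem_erase.2 ⟨fun h => h3 (h ▸ huv.symm), Finset.mem_erase.2 ⟨h2, h1⟩⟩
  obtain ⟨i2, -⟩ := genericReps_extension hu huR hsub2 (hcard _ _) i1 n1
  have hlift : ∀ w ∈ S, (genericReps E G d S (S.erase w)).Nonempty := fun w hw => by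
    obtain ⟨f, hf⟩ := (ih _ (Finset.erase_ssubset hw)).2
    exact ⟨_, update_mem_genericReps (Finset.notMem_erase w S) hf (x := 0) (by simp)⟩
  have hRv : R ⊆ S.erase v := by rw [hR, Finset.erase_right_comm]; exact Finset.erase_subset _ _
  obtain ⟨g, hg⟩ := hlift v hv
  have hRu : R ⊆ S.erase u := Finset.erase_subset _ _
  obtain ⟨f, hf, hfv⟩ := exists_mem_inter_genericReps i2 hRu (hlift u hu)
    (contDiff_gramProduct d (S.erase v)) ⟨g, genericReps_anti hRv hg, hg.2⟩
  obtain ⟨f', hf', h1, h2⟩ := hZ u hu _ _ hp (contDiff_gramProduct d (S.erase v)) hpu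
    ⟨f, hf, hfv⟩
  exact ⟨f', ⟨hf'.1, h2⟩, h1⟩

/-- More than `d` vertices induce a connected subgraph, so a property passed along edges spreads to
all of `S`. -/
theorem SeparatedCardLE.transfer (hG : SeparatedCardLE G d) {S : Finset V} (hS : d < S.card)
    {P : V → Prop} (hP : ∀ u ∈ S, ∀ v ∈ S, G.Adj u v → P u → P v) {u v : V} (hu : u ∈ S)
    (hv : v ∈ S) (hPu : P u) : P v := by
  classical
  by_contra hPv
  have := hG {w ∈ S | P w} {w ∈ S | ¬ P w} (Finset.disjoint_filter_filter_not _ _ _)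
    ⟨u, by simp [hu, hPu]⟩ ⟨v, by simp [hv, hPv]⟩ (fun a ha b hb hab => by
      simp only [Finset.mem_filter] at ha hb
      exact hb.2 (hP a ha.1 b hb.1 hab ha.2))
  rw [Finset.card_filter_add_card_filter_not] at this
  omega

variable [FiniteDimensional ℝ E]

theorem exists_orthogonal_ne_zero (hE : Module.finrank ℝ E = d) {T : Finset V} (hT : T.card < d)
    (f : V → E) : ∃ x : E, x ≠ 0 ∧ ∀ i ∈ T, inner ℝ (f i) x = 0 := by
  classical
  set M : Submodule ℝ E := Submodule.span ℝ (T.image f : Set E)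
  have h1 : Module.finrank ℝ M ≤ T.card :=
    (finrank_span_finset_le_card _).trans Finset.card_image_le
  have h2 := Submodule.finrank_add_finrank_orthogonal M
  have h3 : Mᗮ ≠ ⊥ := fun h => by
    rw [h, finrank_bot] at h2
    omega
  obtain ⟨x, hx, hx0⟩ := Submodule.exists_mem_ne_zero_of_ne_bot h3
  refine ⟨x, hx0, fun i hi => (Submodule.mem_orthogonal M x).1 hx _ (Submodule.subset_span ?_)⟩
  exact Finset.mem_coe.2 (Finset.mem_image_of_mem f hi)

theorem linearIndepOn_update_of_orthogonal {S : Finset V} {v : V} (hv : v ∈ S) {f : V → E}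
    (hf : LinearIndepOn ℝ f (S.erase v : Set V)) {x : E} (hx0 : x ≠ 0)
    (hx : ∀ i ∈ S.erase v, inner ℝ (f i) x = 0) :
    LinearIndepOn ℝ (Function.update f v x) (S : Set V) := by
  have hS : (S : Set V) = insert v (S.erase v : Set V) := by
    rw [← Finset.coe_insert, Finset.insert_erase hv]
  have heq : Set.EqOn (Function.update f v x) f (S.erase v : Set V) := fun i hi =>
    Function.update_of_ne (Finset.ne_of_mem_erase (Finset.mem_coe.1 hi)) _ _
  rw [hS, linearIndepOn_insert (by simp), linearIndepOn_congr heq]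
  refine ⟨hf, ?_⟩
  rw [heq.image_eq, Function.update_self]
  intro hmem
  have : x ∈ (Submodule.span ℝ (f '' (S.erase v : Set V)))ᗮ := by
    rw [Submodule.mem_orthogonal]
    intro y hy
    induction hy using Submodule.span_induction with
    | mem y hy => obtain ⟨i, hi, rfl⟩ := hy; exact hx i (Finset.mem_coe.1 hi)
    | zero => simp
    | add y z _ _ h1 h2 => rw [inner_add_left, h1, h2, add_zero]
    | smul c y _ h1 => rw [inner_smul_left, h1, mul_zero]
  exact hx0 (inner_self_eq_zero.1 ((Submodule.mem_orthogonal _ x).1 this x hmem))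

theorem genericReps_irreducible (hE : Module.finrank ℝ E = d) (hG : SeparatedCardLE G d)
    (hd : 1 ≤ d) (S : Finset V) :
    AnalyticIrreducible (genericReps E G d S S) ∧ (genericReps E G d S S).Nonempty := by
  induction S using Finset.strongInduction with
  | H S ih =>
  rcases S.eq_empty_or_nonempty with rfl | ⟨v, hv⟩
  · have : genericReps E G d ∅ ∅ = Set.univ := by
      ext f
      simp only [genericReps, Set.mem_ofPred_eq, gramProduct_ne_zero_iff, Set.mem_univ, iff_true]
      refine ⟨by simp, fun T hT _ => ?_⟩
      rw [Finset.subset_empty.1 hT, Finset.coe_empty]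
      exact linearIndepOn_empty _ _
    rw [this]
    exact ⟨.of_convex fun _ _ _ _ _ => Set.mem_univ _, Set.univ_nonempty⟩
  have hext : ∀ v ∈ S, AnalyticIrreducible (genericReps E G d S (S.erase v)) ∧
      (genericReps E G d S (S.erase v)).Nonempty := fun v hv => by
    obtain ⟨i, n⟩ := ih _ (Finset.erase_ssubset hv)
    refine genericReps_extension hv (Finset.notMem_erase v S) (fun w hw => ?_)
      (hG.card_nonNeighborsIn_lt hd S v).le i n
    obtain ⟨h1, h2, -⟩ := mem_nonNeighborsIn.1 hw
    exact Finset.mem_erase.2 ⟨h2, h1⟩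
  have hgram : ∀ T ∈ S.powerset.filter fun T => T.card ≤ d,
      ∃ f ∈ genericReps E G d S (S.erase v), (gramOn T f).det ≠ 0 := by
    intro T hT
    obtain ⟨hTS, hTd⟩ : T ⊆ S ∧ T.card ≤ d := by simpa using hT
    -- A small `S` leaves room for a nonzero vector at `v` orthogonal to all others. For a large
    -- `S`, some `u` lies outside `T`; independence on `T` is automatic when `u` is the last vertex,
    -- and is carried from `u` to `v` along edges.
    by_cases hSd : S.card ≤ d
    · obtain ⟨f, hf⟩ := (ih _ (Finset.erase_ssubset hv)).2
      have hlt : (S.erase v).card < d := (Finset.card_erase_lt_of_mem hv).trans_le hSd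
      obtain ⟨x, hx0, hx⟩ := exists_orthogonal_ne_zero hE hlt f
      refine ⟨_, update_mem_genericReps (Finset.notMem_erase v S) hf (x := x) fun i hi => ?_, ?_⟩
      · obtain ⟨h1, h2, -⟩ := mem_nonNeighborsIn.1 hi
        exact hx i (Finset.mem_erase.2 ⟨h2, h1⟩)
      · exact (det_gramOn_ne_zero_iff _ _).2 ((linearIndepOn_update_of_orthogonal hv
          (gramProduct_ne_zero_iff.1 hf.2 _ subset_rfl hlt.le) hx0 hx).mono
            (Finset.coe_subset.2 hTS))
    · obtain ⟨u, hu, huT⟩ := Finset.exists_mem_notMem_of_card_lt_card (s := T) (t := S) (by omega)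
      refine hG.transfer (not_le.1 hSd) (P := fun w =>
        ∃ f ∈ genericReps E G d S (S.erase w), (gramOn T f).det ≠ 0) (fun a ha b hb hab =>
        genericReps_transfer_adj hG hd ih (fun v hv => (hext v hv).1) ha hb hab
          (ContDiff.matrix_det (contDiff_gramOn T))) hu hv ?_
      obtain ⟨f, hf⟩ := (hext u hu).2
      refine ⟨f, hf, (det_gramOn_ne_zero_iff _ _).2 (gramProduct_ne_zero_iff.1 hf.2 T ?_ hTd)⟩
      exact Finset.subset_erase.2 ⟨hTS, huT⟩
  have heq : genericReps E G d S S =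
      {f ∈ genericReps E G d S (S.erase v) | gramProduct d S f ≠ 0} :=
    Set.ext fun f => ⟨fun h => ⟨genericReps_anti (Finset.erase_subset _ _) h, h.2⟩,
      fun h => ⟨h.1.1, h.2⟩⟩
  refine ⟨heq ▸ (hext v hv).1.inter_ne_zero (contDiff_gramProduct d S), ?_⟩
  rw [heq]
  exact (hext v hv).1.exists_prod_ne_zero (hext v hv).2 _ _
    (fun T _ => ContDiff.matrix_det (contDiff_gramOn T)) hgram

theorem exists_genericRep_inner_ne_zero (hE : Module.finrank ℝ E = d) (hG : SeparatedCardLE G d)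
    (hd : 1 ≤ d) {u v : V} (huv : G.Adj u v) :
    ∃ f ∈ genericReps E G d Finset.univ Finset.univ, inner ℝ (f u) (f v) ≠ 0 := by
  set S : Finset V := Finset.univ
  set N := nonNeighborsIn G S v
  have hNS : N ⊆ S.erase v := fun w hw => by
    obtain ⟨h1, h2, -⟩ := mem_nonNeighborsIn.1 hw
    exact Finset.mem_erase.2 ⟨h2, h1⟩
  have hNd : N.card < d := hG.card_nonNeighborsIn_lt hd S v
  obtain ⟨i, n⟩ := genericReps_irreducible hE hG hd (S.erase v)
  obtain ⟨i', -⟩ := genericReps_extension (Finset.mem_univ v) (Finset.notMem_erase v S) hNS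
    hNd.le i n
  refine exists_mem_inter_genericReps i' (Finset.erase_subset _ _)
    (genericReps_irreducible hE hG hd S).2
    ((contDiff_apply ℝ E u).inner ℝ (contDiff_apply ℝ E v)) ?_
  obtain ⟨f, hf⟩ := n
  have huN : u ∉ N := fun h => (mem_nonNeighborsIn.1 h).2.2 huv
  have hind : LinearIndepOn ℝ f (insert u N : Set V) := by
    rw [← Finset.coe_insert]
    refine gramProduct_ne_zero_iff.1 hf.2 _ (Finset.insert_subset ?_ hNS)
      ((Finset.card_insert_le _ _).trans hNd)
    exact Finset.mem_erase.2 ⟨huv.ne, Finset.mem_univ _⟩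
  have hnot := ((linearIndepOn_insert (by simpa using huN)).1 hind).2
  -- Since `f u` is outside the span of the vectors of the non-neighbors of `v`, some choice of the
  -- vector at `v` is orthogonal to that span but not to `f u`.
  obtain ⟨x, hx, hux⟩ : ∃ x ∈ (Submodule.span ℝ (f '' (N : Set V)))ᗮ, inner ℝ (f u) x ≠ 0 := by
    by_contra! h
    apply hnot
    rw [← Submodule.orthogonal_orthogonal (Submodule.span ℝ (f '' (N : Set V))),
      Submodule.mem_orthogonal']
    exact h
  refine ⟨_, update_mem_genericReps (Finset.notMem_erase v S) hf (x := x) fun i hi => ?_, ?_⟩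
  · exact (Submodule.mem_orthogonal _ x).1 hx _ (Submodule.subset_span ⟨i, hi, rfl⟩)
  · simpa [Function.update_of_ne huv.ne] using hux

open Classical in
theorem exists_faithful_genericRep (hE : Module.finrank ℝ E = d) (hG : SeparatedCardLE G d)
    (hd : 1 ≤ d) : ∃ f : V → E,
      (∀ u v, u ≠ v → (inner ℝ (f u) (f v) ≠ 0 ↔ G.Adj u v)) ∧
      ∀ T : Finset V, T.card ≤ d → LinearIndepOn ℝ f (T : Set V) := by
  obtain ⟨i, n⟩ := genericReps_irreducible hE hG hd Finset.univ
  obtain ⟨f, hf, h⟩ := i.exists_prod_ne_zero n {e : V × V | G.Adj e.1 e.2}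
    (fun e f => inner ℝ (f e.1) (f e.2))
    (fun e _ => (contDiff_apply ℝ E e.1).inner ℝ (contDiff_apply ℝ E e.2))
    (fun e he => exists_genericRep_inner_ne_zero hE hG hd (by simpa using he))
  refine ⟨f, fun u v huv => ⟨fun h1 => ?_, fun h1 => ?_⟩, fun T hT =>
    gramProduct_ne_zero_iff.1 hf.2 T (Finset.subset_univ T) hT⟩
  · by_contra h2
    exact h1 (hf.1 u (Finset.mem_univ _) v (Finset.mem_univ _) huv h2)
  · exact Finset.prod_ne_zero_iff.1 h (u, v) (by simpa using h1)

end OrthogonalRepresentations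

/-! ### Connectivity, rank and spark -/

section Connectivity

variable {V : Type*} [Fintype V]

open Classical in
theorem isCutSet_iff_exists_separation {G : SimpleGraph V} {C : Finset V} :
    IsCutSet G C ↔ ∃ A B : Finset V, Disjoint A B ∧ A.Nonempty ∧ B.Nonempty ∧
      (∀ a ∈ A, ∀ b ∈ B, ¬ G.Adj a b) ∧ A ∪ B = Cᶜ := by
  constructor
  · intro h
    simp only [IsCutSet, SimpleGraph.Preconnected, not_forall] at h
    obtain ⟨u, w, huw⟩ := h
    let P : V → Prop := fun x => ∃ hx : x ∉ C, (G.induce {v | v ∉ C}).Reachable u ⟨x, hx⟩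
    refine ⟨{x ∈ Cᶜ | P x}, {x ∈ Cᶜ | ¬ P x}, Finset.disjoint_filter_filter_not _ _ _,
      ⟨u, ?_⟩, ⟨w, ?_⟩, fun a ha b hb hab => ?_, Finset.filter_union_filter_not_eq _ _⟩
    · simp only [Finset.mem_filter, Finset.mem_compl]
      exact ⟨u.2, u.2, .refl _⟩
    · simp only [Finset.mem_filter, Finset.mem_compl]
      exact ⟨w.2, fun ⟨_, h⟩ => huw h⟩
    · simp only [Finset.mem_filter, Finset.mem_compl] at ha hb
      obtain ⟨h1, h2⟩ := ha.2
      refine hb.2 ⟨hb.1, h2.trans (SimpleGraph.Adj.reachable ?_)⟩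
      simpa using hab
  · rintro ⟨A, B, hAB, ⟨a, ha⟩, ⟨b, hb⟩, hadj, hC⟩ h
    have hmem : ∀ x, x ∉ C ↔ x ∈ A ∨ x ∈ B := fun x => by
      rw [← Finset.mem_compl, ← hC, Finset.mem_union]
    obtain ⟨p⟩ := h ⟨a, (hmem a).2 (.inl ha)⟩ ⟨b, (hmem b).2 (.inr hb)⟩
    have key : ∀ x y : {v | v ∉ C}, (G.induce {v | v ∉ C}).Walk x y → x.1 ∈ A → y.1 ∈ A := by
      intro x y p
      induction p with
      | nil => exact id
      | @cons x y z hxy _ ih =>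
        intro hx
        rcases (hmem y.1).1 y.2 with h1 | h1
        · exact ih h1
        · exact (hadj _ hx _ h1 (by simpa using hxy)).elim
    exact Finset.disjoint_left.1 hAB (key _ _ p ha) hb

theorem IsVertexConnected.separatedCardLE {G : SimpleGraph V} {k : ℕ} (hk : k ≤ Fintype.card V)
    (h : IsVertexConnected G (Fintype.card V - k)) : SeparatedCardLE G k := by
  classical
  intro A B hAB hA hB hadj
  have h1 : vertexConnectivity G ≤ (A ∪ B)ᶜ.card :=
    Nat.sInf_le ⟨_, rfl, .inl (isCutSet_iff_exists_separation.2
      ⟨A, B, hAB, hA, hB, hadj, (compl_compl _).symm⟩)⟩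
  have h2 := Finset.card_union_of_disjoint hAB
  have h3 := Finset.card_compl_add_card (A ∪ B)
  have h4 : Fintype.card V - k ≤ vertexConnectivity G := h
  omega

theorem isVertexConnected_of_separatedCardLE {G : SimpleGraph V} {k : ℕ}
    (hk : Fintype.card V = 0 ∨ 1 ≤ k) (h : SeparatedCardLE G k) :
    IsVertexConnected G (Fintype.card V - k) := by
  classical
  refine le_csInf ⟨_, Finset.univ, rfl, .inr (by simp)⟩ ?_
  rintro _ ⟨C, rfl, hC | hC⟩
  · obtain ⟨A, B, hAB, hA, hB, hadj, hU⟩ := isCutSet_iff_exists_separation.1 hC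
    have h1 := h A B hAB hA hB hadj
    have h2 := Finset.card_union_of_disjoint hAB
    have h3 := Finset.card_compl_add_card C
    rw [← hU] at h3
    omega
  -- A set leaving at most one vertex has at least n - 1 elements, which suffices because `1 ≤ k` or
  -- there are no vertices.
  · omega

/-- Restrict the column space to the coordinates in `S`: by symmetry the image has dimension |S|,
and the kernel contains the columns indexed by `T`. -/
theorem Matrix.card_add_card_le_rank_of_block_zero {A : Matrix V V ℝ} (hA : A.IsSymm)
    {S T : Finset V} (hS : LinearIndepOn ℝ A.col (S : Set V))
    (hT : LinearIndepOn ℝ A.col (T : Set V)) (h0 : ∀ s ∈ S, ∀ t ∈ T, A s t = 0) :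
    S.card + T.card ≤ A.rank := by
  classical
  set R := LinearMap.range A.mulVecLin
  set π : (V → ℝ) →ₗ[ℝ] (S → ℝ) := LinearMap.funLeft ℝ ℝ (fun s : S => (s : V))
  have h1 := LinearMap.finrank_range_add_finrank_ker (π.domRestrict R)
  have hB : (A.submatrix (fun s : S => (s : V)) id).rank = S.card := by
    have : LinearIndependent ℝ (A.submatrix (fun s : S => (s : V)) id).row := by
      have h : (A.submatrix (fun s : S => (s : V)) id).row = fun s : S => A.col s := by
        ext s t
        exact hA.apply t s
      rw [h]
      exact hS
    simpa using this.rank_matrix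
  have h2 : S.card ≤ Module.finrank ℝ (LinearMap.range (π.domRestrict R)) := by
    rw [← hB, Matrix.rank]
    refine Submodule.finrank_mono ?_
    rintro _ ⟨x, rfl⟩
    exact ⟨⟨A.mulVecLin x, x, rfl⟩, rfl⟩
  have h3 : T.card ≤ Module.finrank ℝ (LinearMap.ker (π.domRestrict R)) := by
    have hcol : ∀ t, A.col t ∈ R := fun t => ⟨Pi.single t 1, by simp⟩
    have hmem : ∀ t : T, (⟨A.col t, hcol t⟩ : R) ∈ LinearMap.ker (π.domRestrict R) := by
      intro t
      rw [LinearMap.mem_ker]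
      ext s
      exact h0 s s.2 t t.2
    have hli : LinearIndependent ℝ
        (fun t : T => (⟨_, hmem t⟩ : LinearMap.ker (π.domRestrict R))) := by
      refine LinearIndependent.of_comp (R.subtype ∘ₗ Submodule.subtype _) ?_
      exact hT
    simpa using hli.fintype_card_le_finrank
  have h4 : A.rank = Module.finrank ℝ R := rfl
  omega

theorem separatedCardLE_of_linearIndepOn_nonNeighbors {G : SimpleGraph V} {A : Matrix V V ℝ}
    (hA : A ∈ matricesOf G) (h : ∀ v, LinearIndepOn ℝ A.col (nonNeighbors G v)) :
    SeparatedCardLE G A.rank := by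
  intro S T hST ⟨s, hs⟩ ⟨t, ht⟩ hadj
  have hne : ∀ a ∈ S, ∀ b ∈ T, a ≠ b := fun a ha b hb hab =>
    Finset.disjoint_left.1 hST ha (hab ▸ hb)
  refine Matrix.card_add_card_le_rank_of_block_zero hA.1 ((h t).mono fun a ha => ?_)
    ((h s).mono fun b hb => ?_) fun a ha b hb => ?_
  · exact ⟨hne a ha t ht, fun hta => hadj a ha t ht hta.symm⟩
  · exact ⟨(hne s hs b hb).symm, hadj s hs b hb⟩
  · by_contra hab
    exact hadj a ha b hb ((hA.2 a b (hne a ha b hb)).1 hab)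

theorem matricesOf_rank_pos {G : SimpleGraph V} {A : Matrix V V ℝ} (hA : A ∈ matricesOf G)
    {v w : V} (h : G.Adj v w) : 0 < A.rank := by
  classical
  refine Nat.pos_of_ne_zero fun h0 => ?_
  have : A.mulVecLin = 0 := by
    rw [← LinearMap.range_eq_bot]
    exact Submodule.finrank_eq_zero.1 h0
  have hvw : A.mulVecLin (Pi.single w 1) v = 0 := by rw [this]; rfl
  exact (hA.2 v w h.ne).2 h (by simpa using hvw)

/-- The Gram columns are the images of the `f j` under x ↦ (⟨f i, x⟩)ᵢ, which is injective because
the `f i` span. -/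
theorem rank_gram_and_linearIndepOn_col {E : Type*} [NormedAddCommGroup E]
    [InnerProductSpace ℝ E] [FiniteDimensional ℝ E] (hk : Module.finrank ℝ E ≤ Fintype.card V)
    {f : V → E}
    (h : ∀ T : Finset V, T.card ≤ Module.finrank ℝ E → LinearIndepOn ℝ f (T : Set V)) :
    (Matrix.gram ℝ f).rank = Module.finrank ℝ E ∧
      ∀ T : Finset V, T.card ≤ Module.finrank ℝ E →
        LinearIndepOn ℝ (Matrix.gram ℝ f).col (T : Set V) := by
  let Φ : E →ₗ[ℝ] (V → ℝ) := LinearMap.pi fun i => (innerₛₗ ℝ (f i))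
  have hcol : (Matrix.gram ℝ f).col = Φ ∘ f := by
    ext i j
    simp [Φ, Matrix.gram_apply]
  obtain ⟨S, -, hS⟩ := Finset.exists_subset_card_eq (s := (Finset.univ : Finset V))
    (n := Module.finrank ℝ E) (by simpa using hk)
  have hspan : Submodule.span ℝ (Set.range f) = ⊤ := by
    have h1 := (h S hS.le).linearIndependent.span_eq_top_of_card_eq_finrank' (by simpa using hS)
    refine top_unique (h1.symm.le.trans (Submodule.span_mono ?_))
    rintro _ ⟨s, rfl⟩
    exact ⟨s, rfl⟩
  have hker : LinearMap.ker Φ = ⊥ := by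
    rw [LinearMap.ker_eq_bot']
    intro x hx
    have h2 : ∀ y ∈ Submodule.span ℝ (Set.range f), inner ℝ y x = 0 := by
      intro y hy
      induction hy using Submodule.span_induction with
      | mem y hy => obtain ⟨i, rfl⟩ := hy; exact congrFun hx i
      | zero => simp
      | add y z _ _ h1 h2 => rw [inner_add_left, h1, h2, add_zero]
      | smul c y _ h1 => rw [inner_smul_left, h1, mul_zero]
    exact inner_self_eq_zero.1 (h2 x (hspan ▸ Submodule.mem_top))
  refine ⟨?_, fun T hT => ?_⟩
  · rw [Matrix.rank_eq_finrank_span_cols, hcol, Set.range_comp, Submodule.span_image, hspan,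
      Submodule.map_top, LinearMap.finrank_range_of_inj (LinearMap.ker_eq_bot.1 hker)]
  · rw [hcol]
    exact (h T hT).linearIndependent.map' Φ hker

variable [DecidableEq V]

theorem linearIndepOn_col_of_spark {A : Matrix V V ℝ} {k : ℕ} (hA : spark A = k + 1)
    {T : Finset V} (hT : T.card ≤ k) : LinearIndepOn ℝ A.col (T : Set V) := by
  by_cases h : A.det = 0
  · rw [spark, if_neg (by simpa using h)] at hA
    by_contra hT'
    have := Nat.sInf_le (s := {s | ∃ S : Finset V, S.card = s ∧
      ¬ LinearIndepOn ℝ A.col (S : Set V)}) ⟨T, rfl, hT'⟩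
    omega
  · have h1 : LinearIndependent ℝ A.col := Matrix.linearIndependent_cols_iff_isUnit.2
      ((Matrix.isUnit_iff_isUnit_det A).2 (isUnit_iff_ne_zero.2 h))
    exact h1.linearIndepOn _

theorem spark_eq_of_linearIndepOn_col {A : Matrix V V ℝ} {k : ℕ} (hk : k ≤ Fintype.card V)
    (hrank : A.rank = k)
    (h : ∀ T : Finset V, T.card ≤ k → LinearIndepOn ℝ A.col (T : Set V)) : spark A = k + 1 := by
  have hdep : ∀ T : Finset V, LinearIndepOn ℝ A.col (T : Set V) → T.card ≤ k := fun T hT => by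
    rw [← hrank, Matrix.rank_eq_finrank_span_cols]
    have := finrank_span_eq_card (R := ℝ) (b := fun t : T => A.col t) hT
    rw [Fintype.card_coe] at this
    rw [← this]
    refine Submodule.finrank_mono (Submodule.span_mono ?_)
    rintro _ ⟨t, rfl⟩
    exact ⟨t, rfl⟩
  by_cases hdet : A.det = 0
  · rw [spark, if_neg (by simpa using hdet)]
    have hlt : k < Fintype.card V := by
      refine lt_of_le_of_ne hk fun hkn => ?_
      have h1 : LinearIndependent ℝ A.col := by
        have := h Finset.univ (by simp [hkn])
        rwa [Finset.coe_univ, linearIndepOn_univ_iff] at this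
      have h2 := (Matrix.isUnit_iff_isUnit_det A).1 (Matrix.linearIndependent_cols_iff_isUnit.1 h1)
      exact h2.ne_zero hdet
    obtain ⟨S, -, hS⟩ := Finset.exists_subset_card_eq (s := (Finset.univ : Finset V))
      (n := k + 1) (by simpa using hlt)
    apply le_antisymm
    · exact Nat.sInf_le ⟨S, hS, fun hli => by have := hdep S hli; omega⟩
    · refine le_csInf ⟨_, S, rfl, fun hli => by have := hdep S hli; omega⟩ ?_
      rintro _ ⟨T, rfl, hT⟩
      by_contra hlt'
      exact hT (h T (by omega))
  · rw [spark, if_pos hdet]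
    have h1 : LinearIndependent ℝ A.col := Matrix.linearIndependent_cols_iff_isUnit.2
      ((Matrix.isUnit_iff_isUnit_det A).2 (isUnit_iff_ne_zero.2 hdet))
    have := hdep Finset.univ (h1.linearIndepOn _)
    rw [Finset.card_univ] at this
    omega

theorem exists_matrix_of_separatedCardLE {G : SimpleGraph V} {k : ℕ} (hk : 1 ≤ k)
    (hkn : k ≤ Fintype.card V) (hG : SeparatedCardLE G k) :
    ∃ A ∈ matricesOf G, A.rank = k ∧ spark A = k + 1 := by
  have hE : Module.finrank ℝ (EuclideanSpace ℝ (Fin k)) = k := by simp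
  obtain ⟨f, h1, h2⟩ := exists_faithful_genericRep (G := G)
    (E := EuclideanSpace ℝ (Fin k)) hE hG hk
  obtain ⟨h3, h4⟩ := rank_gram_and_linearIndepOn_col (f := f) (by rwa [hE]) (by rwa [hE])
  rw [hE] at h3 h4
  refine ⟨Matrix.gram ℝ f, ⟨?_, h1⟩, h3, spark_eq_of_linearIndepOn_col hkn h3 h4⟩
  ext i j
  exact real_inner_comm (f i) (f j)

theorem linearIndepOn_col_closed_nonNeighbors {G : SimpleGraph V} {A : Matrix V V ℝ}
    (hA : A ∈ matricesOf G) (hpos : 0 < A.rank) (hspark : spark A = A.rank + 1) (v : V) :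
    LinearIndepOn ℝ A.col (insert v (nonNeighbors G v)) := by
  classical
  set N : Finset V := {w | w ∈ nonNeighbors G v} with hN
  have hcoe : (insert v (nonNeighbors G v) : Set V) = (insert v N : Finset V) := by
    ext; simp [hN]
  have hcard : N.card < A.rank := by
    -- Otherwise rank-many non-neighbors span the column space; their columns vanish at `v`, so row
    -- `v`, and by symmetry column `v`, is zero.
    by_contra! hle
    obtain ⟨T, hTN, hT⟩ := Finset.exists_subset_card_eq hle
    have hli := linearIndepOn_col_of_spark hspark hT.le
    have hspan : Submodule.span ℝ (Set.range fun t : T => A.col t)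
        = Submodule.span ℝ (Set.range A.col) := by
      refine Submodule.eq_of_le_of_finrank_eq (Submodule.span_mono ?_) ?_
      · rintro _ ⟨t, rfl⟩
        exact ⟨t, rfl⟩
      · have h := finrank_span_eq_card (R := ℝ) (b := fun t : T => A.col t) hli
        rw [Fintype.card_coe, hT] at h
        exact h.trans A.rank_eq_finrank_span_cols
    have hker : Submodule.span ℝ (Set.range fun t : T => A.col t)
        ≤ LinearMap.ker (LinearMap.proj v : (V → ℝ) →ₗ[ℝ] ℝ) := by
      rw [Submodule.span_le]
      rintro _ ⟨t, rfl⟩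
      obtain ⟨h1, h2⟩ : (t : V) ∈ nonNeighbors G v := by simpa [hN] using hTN t.2
      by_contra h3
      exact h2 ((hA.2 v t h1.symm).1 h3)
    have hv0 : A.col v = 0 := by
      ext w
      have : A v w = 0 := by
        have hmem : A.col w ∈ Submodule.span ℝ (Set.range A.col) := Submodule.subset_span ⟨w, rfl⟩
        rw [← hspan] at hmem
        exact hker hmem
      exact (hA.1.apply v w).trans this
    have hv : LinearIndepOn ℝ A.col (({v} : Finset V) : Set V) :=
      linearIndepOn_col_of_spark hspark (by rw [Finset.card_singleton]; exact hpos)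
    exact hv.ne_zero (by simp) hv0
  rw [hcoe]
  exact linearIndepOn_col_of_spark hspark ((Finset.card_insert_le _ _).trans hcard)

end Connectivity

/-! ### The equivalences -/

theorem mainTheorem5 {V : Type*} [Fintype V] [DecidableEq V] (G : SimpleGraph V) (k : ℕ)
    (hkn : k ≤ Fintype.card V)
    (hk0 : k = 0 → ∀ v : V, ∃ w : V, G.Adj v w) :
    List.TFAE [
      IsVertexConnected G (Fintype.card V - k),
      ∃ A ∈ matricesOf G, A.rank = k ∧ spark A = k + 1,
      ∃ A ∈ matricesOf G, A.rank = k ∧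
        ∀ v : V, LinearIndepOn ℝ A.col (insert v (nonNeighbors G v)),
      ∃ A ∈ matricesOf G, A.rank = k ∧
        ∀ v : V, LinearIndepOn ℝ A.col (nonNeighbors G v)] := by
  have hpos : ∀ A ∈ matricesOf G, A.rank = k → ∀ _ : V, 0 < A.rank := by
    intro A hA hr v
    by_contra h0
    obtain ⟨w, hw⟩ := hk0 (by omega) v
    exact h0 (matricesOf_rank_pos hA hw)
  tfae_have 1 → 2 := by
    intro h
    rcases Nat.eq_zero_or_pos k with rfl | hk
    -- On a nonempty vertex set κ is at most n - 1, so `k = 0` forces `V` to be empty; the empty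
    -- matrix has determinant 1, hence spark 0 + 1.
    · have hle : Fintype.card V - 0 ≤ vertexConnectivity G := h
      have hV : IsEmpty V := by
        by_contra hV
        rw [not_isEmpty_iff] at hV
        obtain ⟨C, -, hC⟩ := Finset.exists_subset_card_eq (s := (Finset.univ : Finset V))
          (n := Fintype.card V - 1) (by simp)
        have : vertexConnectivity G ≤ C.card := Nat.sInf_le ⟨C, rfl, .inr (by omega)⟩
        have := Fintype.card_pos (α := V)
        omega
      exact ⟨0, ⟨Matrix.isSymm_zero, fun i => hV.elim i⟩, by simp, by simp [spark]⟩
    · exact exists_matrix_of_separatedCardLE hk hkn (h.separatedCardLE hkn)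
  tfae_have 2 → 3 := by
    rintro ⟨A, hA, rfl, hs⟩
    exact ⟨A, hA, rfl, fun v => linearIndepOn_col_closed_nonNeighbors hA (hpos A hA rfl v) hs v⟩
  tfae_have 3 → 4 := by
    rintro ⟨A, hA, hr, h⟩
    exact ⟨A, hA, hr, fun v => (h v).mono (Set.subset_insert _ _)⟩
  tfae_have 4 → 1 := by
    rintro ⟨A, hA, rfl, h⟩
    refine isVertexConnected_of_separatedCardLE ?_
      (separatedCardLE_of_linearIndepOn_nonNeighbors hA h)
    rcases isEmpty_or_nonempty V with hV | ⟨⟨v⟩⟩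
    · exact .inl Fintype.card_eq_zero
    · exact .inr (hpos A hA rfl v)
  tfae_finish
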